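/- Let $G$ be a finite simple graph with maximum degree $\Delta$ and arboricity $\alpha$ (the minimum number of forests into which $E(G)$ can be partitioned), and let $p>0$. Consider the following randomized algorithm, which maintains a set $I$ of nodes, a set $B$ of ``bad'' nodes and a set $V_{IB}$ of active nodes; initially $I=B=\emptyset$ and $V_{IB}=V(G)$. For an active node $v$, let $\Gamma_{IB}(v)$ be the set of its neighbours in $V_{IB}$ and $\deg_{IB}(v)=|\Gamma_{IB}(v)|$. For each scale $k=1,\dots,\Theta$, where $\Theta=\left\lfloor\log_2\frac{\Delta}{1176\cdot 16\,\alpha^{10}\ln^2\Delta}\right\rfloor$, put $\rho_k=8\ln\Delta\cdot\Delta/2^{k+1}$ and do the following. (a) Perform $\Lambda=\left\lceil p\cdot 8\alpha^2(32\alpha^6+1)\ln(260\,\alpha^4\ln^2\Delta)\right\rceil$ iterations. In each iteration every active node $v$ chooses a priority $r(v)$: it is $0$ if $\deg_{IB}(v)>\rho_k$, and otherwise a fresh independent uniform random real in $(0,1)$. Every $v\in V_{IB}$ with $r(v)>r(w)$ for all $w\in\Gamma_{IB}(v)$ is added to $I$; then all nodes of $I$ and all active neighbours of nodes of $I$ are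 removed from $V_{IB}$ (they are eliminated). (b) Then every $v\in V_{IB}$ with $\left|\{w\in\Gamma_{IB}(v):\deg_{IB}(w)>\Delta/2^k+\alpha\}\right|>\Delta/2^{k+2}$ is moved from $V_{IB}$ to $B$. Theorem (Event (3)). Fix a scale $k$ with $1\le k\le\Theta$ and one of the $\Lambda$ iterations of this scale, and fix any outcome of the random choices made before this iteration. Let $V_{IB}$ be the resulting set of nodes that are active just before the iteration, and let $M\subseteq V_{IB}$ satisfy $|M|>\Delta/2^{k+2}$ and $\deg_{IB}(w)>\Delta/2^k+\alpha$ for all $w\in M$. Then, with probability at least $1-1/\Delta^3$ over the random priorities of this iteration, at least $$\frac{|M|}{8\alpha^2(32\alpha^6+1)}$$ nodes of $M$ are eliminated in this iteration. -/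

import Mathlib

open MeasureTheory

noncomputable section

namespace BoundedArb

/-- The edge set of `G` can be partitioned into (at most) `a` forests. Forests of the partition
may be empty; disjointness in the lattice of graphs on `V` means having no common edge. -/
def HasForestPartition {V : Type*} (G : SimpleGraph V) (a : ℕ) : Prop :=
  ∃ F : Fin a → SimpleGraph V,
    (∀ j, (F j).IsAcyclic) ∧ Pairwise (fun i j => Disjoint (F i) (F j)) ∧ ⨆ j, F j = G

/-- The arboricity: the minimum number of forests into which the edges can be partitioned. -/
def arboricity {V : Type*} (G : SimpleGraph V) : ℕ := sInf {a | HasForestPartition G a}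

/-- The number of scales, `Θ = ⌊log₂ (Δ / (1176 · 16 α¹⁰ ln² Δ))⌋`
(there is no scale when this is not positive). -/
def numScales (Δ α : ℕ) : ℕ :=
  ⌊Real.logb 2 ((Δ : ℝ) / (1176 * 16 * (α : ℝ) ^ 10 * Real.log Δ ^ 2))⌋₊

/-- The number of iterations in each scale,
`Λ = ⌈p · 8 α² (32 α⁶ + 1) · ln (260 α⁴ ln² Δ)⌉`. -/
def numIterations (Δ α : ℕ) (p : ℝ) : ℕ :=
  ⌈p * (8 * (α : ℝ) ^ 2 * (32 * (α : ℝ) ^ 6 + 1)) *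
    Real.log (260 * (α : ℝ) ^ 4 * Real.log Δ ^ 2)⌉₊

/-- The degree threshold `ρ_k = 8 ln Δ · Δ / 2^(k+1)` above which a node does not compete. -/
def rho (Δ k : ℕ) : ℝ := 8 * Real.log Δ * ((Δ : ℝ) / 2 ^ (k + 1))

/-- The state of the algorithm: the set `I` of nodes that have joined the independent set, the
set `B` of bad nodes, and the set `V_IB` of nodes that are still active. -/
structure State (V : Type*) where
  I : Finset V
  B : Finset V
  active : Finset V

section Algorithm

variable {V : Type*} [Fintype V] [DecidableEq V] (G : SimpleGraph V) [DecidableRel G.Adj]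

/-- `Γ_IB(v)`: the neighbours of `v` in the set `A` of active nodes. -/
def activeNbrs (A : Finset V) (v : V) : Finset V := {w ∈ A | G.Adj v w}

/-- `deg_IB(v)`. -/
def activeDeg (A : Finset V) (v : V) : ℕ := (activeNbrs G A v).card

/-- The priorities `r(v)` in an iteration of scale `k` with active set `A`, where `u v` is the
random real drawn by `v`: a node of active degree more than `ρ_k` has priority `0`. -/
def priority (k : ℕ) (A : Finset V) (u : V → ℝ) (v : V) : ℝ :=
  if (activeDeg G A v : ℝ) > rho G.maxDegree k then 0 else u v

/-- The active nodes whose priority exceeds the priorities of all their active neighbours. -/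
def winners (k : ℕ) (A : Finset V) (u : V → ℝ) : Finset V :=
  {v ∈ A | ∀ w ∈ activeNbrs G A v, priority G k A u w < priority G k A u v}

/-- One iteration of scale `k`, with draws `u`: the winners join `I`, and then all members
of `I` and all their active neighbours become inactive. -/
def iteration (k : ℕ) (s : State V) (u : V → ℝ) : State V where
  I := s.I ∪ winners G k s.active u
  B := s.B
  active := s.active \ ((s.I ∪ winners G k s.active u) ∪
    (s.I ∪ winners G k s.active u).biUnion (activeNbrs G s.active))

/-- The state after `i` iterations of scale `k` from state `s`, where `u j` are the draws of
the iteration number `j` of that scale (counted from `0`). -/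
def iterations (k : ℕ) (s : State V) (u : ℕ → V → ℝ) : ℕ → State V
  | 0 => s
  | i + 1 => iteration G k (iterations k s u i) (u i)

/-- The active nodes that are marked bad at the end of scale `k`: those with more than
`Δ / 2^(k+2)` active neighbours of active degree more than `Δ / 2^k + α`. -/
def badNodes (α k : ℕ) (A : Finset V) : Finset V :=
  {v ∈ A | (({w ∈ activeNbrs G A v |
      (activeDeg G A w : ℝ) > (G.maxDegree : ℝ) / 2 ^ k + α} : Finset V).card : ℝ) >
    (G.maxDegree : ℝ) / 2 ^ (k + 2)}

/-- The end of scale `k`: bad nodes are moved from the active set to `B`. -/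
def removeBad (α k : ℕ) (s : State V) : State V where
  I := s.I
  B := s.B ∪ badNodes G α k s.active
  active := s.active \ badNodes G α k s.active

/-- The state after the scales `1, …, k` have been completed, where `u j i` are the draws in
iteration `i` of scale `j`. Initially `I` and `B` are empty and all nodes are active. -/
def afterScale (α : ℕ) (p : ℝ) (u : ℕ → ℕ → V → ℝ) : ℕ → State V
  | 0 => ⟨∅, ∅, Finset.univ⟩
  | k + 1 => removeBad G α (k + 1)
      (iterations G (k + 1) (afterScale α p u k) (u (k + 1)) (numIterations G.maxDegree α p))

/-- The state just before iteration `i` (counted from `0`) of scale `k ≥ 1`. It depends only on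
the draws of the earlier iterations. -/
def stateBefore (α : ℕ) (p : ℝ) (u : ℕ → ℕ → V → ℝ) (k i : ℕ) : State V :=
  iterations G k (afterScale G α p u (k - 1)) (u k) i

/-- The law of the draws of one iteration: independent uniform reals in `(0,1)`. -/
def drawLaw (V : Type*) [Fintype V] : Measure (V → ℝ) :=
  Measure.pi fun _ => (volume : Measure ℝ).restrict (Set.Ioo 0 1)

end Algorithm

end BoundedArb

end

namespace BoundedArb

open ProbabilityTheory

/-! Write D = Δ/2^k, L = ln Δ and a = α. Nodes that were bad at the end of the previous scale are no
longer active, so each w ∈ M has at most D/2 active neighbours of active degree above 2D + a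
(`card_high_activeNbrs_le`). Hence w has more than D/2 active neighbours of low degree; fix m =
⌊D/2⌋ + 1 of them as candidates.

A union of a forests is sparse, so the candidate sets overlap little, and their union contains an
independent set I with |I| ≥ |M|D/(9a²). Assign each v ∈ I to one w ∈ M adjacent to it
(`exists_independent_candidates`).

Let q = 1/(8D) and call a draw above 1 - q a hit. If v ∈ I has a hit and no competing neighbour of v
does, then v wins and its assigned w is eliminated. Hits inside I do not interfere with each other,
since I is independent. A competitor outside I that has a hit blocks at most ρ_k = 4LD vertices of
I, and the expected number of blockings is about |I|/4. A Chernoff bound with weights at most ρ_k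
shows that fewer than |I|/2 blockings occur, except with probability e^(-6L). Given the hits outside
I, the draws inside I are still independent, and the fibres of the assignment are disjoint. A second
Chernoff bound therefore gives more than |M|/(264a²) fibres with an unblocked hit
(`isolatedHits_lower_tail`). The two failure probabilities add up to at most e^(-3L) = Δ^(-3), and
264a² ≤ 8a²(32a⁶ + 1). -/

instance isProbabilityMeasure_restrict_Ioo :
    IsProbabilityMeasure ((volume : Measure ℝ).restrict (Set.Ioo 0 1)) :=
  ⟨by simp⟩

instance isProbabilityMeasure_drawLaw (V : Type*) [Fintype V] :
    IsProbabilityMeasure (drawLaw V) := by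
  unfold drawLaw; infer_instance

/-! ### Independence of the draws and two Chernoff bounds. -/

section Draws

variable {V : Type*} [Fintype V] [DecidableEq V]

/-- Functions of disjoint sets of draws are independent. -/
theorem indepFun_of_dependsOn {β γ : Type*} [MeasurableSpace β] [MeasurableSpace γ]
    {S T : Finset V} (hST : Disjoint S T) {f : (V → ℝ) → β} {g : (V → ℝ) → γ}
    (hf : Measurable f) (hg : Measurable g)
    (hfS : DependsOn f (S : Set V)) (hgT : DependsOn g (T : Set V)) :
    IndepFun f g (drawLaw V) := by
  have key := (iIndepFun_pi (μ := fun _ : V => (volume : Measure ℝ).restrict (Set.Ioo 0 1))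
    (X := fun _ => id) (fun _ => aemeasurable_id)).indepFun_finset S T hST
    (fun i => measurable_pi_apply i)
  have ext_meas (R : Finset V) :
      Measurable (fun (x : R → ℝ) (i : V) => if h : i ∈ R then x ⟨i, h⟩ else 0) := by
    refine measurable_pi_lambda _ fun i => ?_
    by_cases h : i ∈ R
    · simpa [h] using measurable_pi_apply _
    · simp [h]
  have := key.comp (hf.comp (ext_meas S)) (hg.comp (ext_meas T))
  refine (show IndepFun _ _ (drawLaw V) from this).congr ?_ ?_
  · refine Filter.Eventually.of_forall fun u => hfS fun i hi => ?_
    simp [Finset.mem_coe.mp hi]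
  · refine Filter.Eventually.of_forall fun u => hgT fun i hi => ?_
    simp [Finset.mem_coe.mp hi]

theorem volume_real_draw_gt {q : ℝ} (hq0 : 0 ≤ q) (hq1 : q ≤ 1) :
    ((volume : Measure ℝ).restrict (Set.Ioo 0 1)).real (Set.Ioi (1 - q)) = q := by
  have : Set.Ioi (1 - q) ∩ Set.Ioo 0 1 = Set.Ioo (1 - q) 1 := by
    rw [← Set.Ioi_inter_Iio, ← Set.inter_assoc, Set.Ioi_inter_Ioi, Set.Ioi_inter_Iio,
      sup_of_le_left (by linarith)]
  rw [measureReal_restrict_apply measurableSet_Ioi, this]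
  simp [hq0]

theorem volume_real_draw_le {q : ℝ} (hq0 : 0 ≤ q) (hq1 : q ≤ 1) :
    ((volume : Measure ℝ).restrict (Set.Ioo 0 1)).real (Set.Iic (1 - q)) = 1 - q := by
  rw [← Set.compl_Ioi, probReal_compl_eq_one_sub measurableSet_Ioi, volume_real_draw_gt hq0 hq1]

omit [Fintype V] [DecidableEq V] in
theorem measurableSet_draw_gt (q : ℝ) (v : V) : MeasurableSet {u : V → ℝ | 1 - q < u v} :=
  measurableSet_lt measurable_const (measurable_pi_apply v)

omit [Fintype V] [DecidableEq V] in
theorem measurableSet_exists_draw_gt (q : ℝ) (F : Finset V) :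
    MeasurableSet {u : V → ℝ | ∃ v ∈ F, 1 - q < u v} := by
  have : {u : V → ℝ | ∃ v ∈ F, 1 - q < u v} = ⋃ v ∈ F, {u : V → ℝ | 1 - q < u v} := by
    ext u; simp
  rw [this]
  exact Finset.measurableSet_biUnion _ fun v _ => measurableSet_draw_gt q v

theorem drawLaw_real_exists_gt {q : ℝ} (hq0 : 0 ≤ q) (hq1 : q ≤ 1) (F : Finset V) :
    (drawLaw V).real {u | ∃ v ∈ F, 1 - q < u v} = 1 - (1 - q) ^ F.card := by
  have h1 : {u : V → ℝ | ∃ v ∈ F, 1 - q < u v}ᶜ =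
      Set.univ.pi fun v => if v ∈ F then Set.Iic (1 - q) else Set.univ := by
    ext u
    simp only [Set.mem_compl_iff, Set.mem_ofPred_eq, not_exists, not_and, not_lt, Set.mem_pi,
      Set.mem_univ, true_imp_iff]
    refine forall_congr' fun v => ?_
    by_cases h : v ∈ F <;> simp [h]
  have h2 : (drawLaw V).real {u : V → ℝ | ∃ v ∈ F, 1 - q < u v}ᶜ = (1 - q) ^ F.card := by
    rw [h1, drawLaw, measureReal_def, Measure.pi_pi, ENNReal.toReal_prod]
    have : ∀ v : V, (((volume : Measure ℝ).restrict (Set.Ioo 0 1))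
        (if v ∈ F then Set.Iic (1 - q) else Set.univ)).toReal = if v ∈ F then 1 - q else 1 := by
      intro v
      split_ifs
      · exact volume_real_draw_le hq0 hq1
      · simp
    simp_rw [this]
    simp [Finset.prod_ite_mem]
  rw [probReal_compl_eq_one_sub (measurableSet_exists_draw_gt q F)] at h2
  linarith

theorem exp_le_one_add_of_le_half {x : ℝ} (h0 : 0 ≤ x) (h1 : x ≤ 1 / 2) :
    Real.exp x ≤ 1 + 3 / 2 * x := by
  have := (abs_le.mp (Real.abs_exp_sub_one_sub_id_le (x := x) (by rw [abs_of_nonneg h0]; linarith))).2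
  nlinarith

omit [DecidableEq V] in
/-- A Chernoff bound for the total weight of the vertices whose draw exceeds `1 - q`. -/
theorem upper_tail {q : ℝ} (hq0 : 0 ≤ q) (hq1 : q ≤ 1) (h : V → ℝ) {b : ℝ} (hb : 0 < b)
    (h0 : ∀ v, 0 ≤ h v) (hle : ∀ v, h v ≤ b) (t : ℝ) :
    (drawLaw V).real {u | t ≤ ∑ v, if 1 - q < u v then h v else 0} ≤
      Real.exp ((-t + 3 / 2 * q * ∑ v, h v) / (2 * b)) := by
  -- This choice makes every s * h v at most 1/2, the range in which exp x ≤ 1 + 3x/2 is available.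
  set s : ℝ := 1 / (2 * b) with hs
  have hs0 : 0 < s := by positivity
  set X : (V → ℝ) → ℝ := fun u => ∑ v, if 1 - q < u v then h v else 0 with hX
  have hXm : Measurable X := by
    refine Finset.measurable_sum _ fun v _ => ?_
    exact Measurable.ite (measurableSet_draw_gt q v) measurable_const measurable_const
  have hXb : ∀ u, |X u| ≤ ∑ v, h v := by
    intro u
    rw [abs_of_nonneg (Finset.sum_nonneg fun v _ => by split_ifs <;> simp [h0 v])]
    exact Finset.sum_le_sum fun v _ => by split_ifs <;> simp [h0 v]
  have hint : Integrable (fun u => Real.exp (s * X u)) (drawLaw V) := by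
    refine Integrable.of_bound (C := Real.exp (s * ∑ v, h v))
      (by fun_prop) (Filter.Eventually.of_forall fun u => ?_)
    rw [Real.norm_eq_abs, Real.abs_exp]
    have := (abs_le.mp (hXb u)).2
    gcongr
  have h1 := measure_ge_le_exp_mul_mgf (μ := drawLaw V) (X := X) t hs0.le hint
  refine h1.trans ?_
  have h2 : mgf X (drawLaw V) s = ∏ v, (1 + q * (Real.exp (s * h v) - 1)) := by
    have e : (fun u => Real.exp (s * X u)) =
        fun u : V → ℝ => ∏ v, Real.exp (s * if 1 - q < u v then h v else 0) := by
      ext u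
      rw [hX, Finset.mul_sum, Real.exp_sum]
    rw [mgf, e, drawLaw, integral_fintype_prod_eq_prod
      (f := fun v x => Real.exp (s * if 1 - q < x then h v else 0))]
    refine Finset.prod_congr rfl fun v _ => ?_
    have e2 : (fun x : ℝ => Real.exp (s * if 1 - q < x then h v else 0)) =
        fun x => 1 + (Set.Ioi (1 - q)).indicator (fun _ => Real.exp (s * h v) - 1) x := by
      ext x
      by_cases hx : 1 - q < x <;> simp [hx]
    rw [e2, integral_add (integrable_const _)
      ((integrable_const _).indicator measurableSet_Ioi),
      integral_indicator_const _ measurableSet_Ioi, volume_real_draw_gt hq0 hq1]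
    simp
  have h3 : mgf X (drawLaw V) s ≤ Real.exp (∑ v, q * (3 / 2 * (s * h v))) := by
    rw [h2, Real.exp_sum]
    refine Finset.prod_le_prod (fun v _ => ?_) fun v _ => ?_
    · have : 1 ≤ Real.exp (s * h v) := Real.one_le_exp (mul_nonneg hs0.le (h0 v))
      nlinarith
    · have := exp_le_one_add_of_le_half (x := s * h v) (mul_nonneg hs0.le (h0 v)) (by
        rw [hs, one_div, inv_mul_eq_div, div_le_div_iff₀ (by positivity) (by norm_num)]
        linarith [hle v])
      have h4 := Real.add_one_le_exp (q * (3 / 2 * (s * h v)))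
      nlinarith
  calc _ ≤ Real.exp (-s * t) * Real.exp (∑ v, q * (3 / 2 * (s * h v))) := by gcongr
    _ = _ := by
      rw [← Real.exp_add]
      congr 1
      simp_rw [← Finset.mul_sum]
      rw [hs]
      ring

/-- The number of sets of the family `F`, indexed by `W`, with a vertex whose draw exceeds
`1 - q`. -/
noncomputable def hitCount {ι : Type*} (q : ℝ) (W : Finset ι) (F : ι → Finset V) (u : V → ℝ) : ℝ :=
  ∑ w ∈ W, {u : V → ℝ | ∃ v ∈ F w, 1 - q < u v}.indicator (fun _ => 1) u

variable {ι : Type*}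

omit [Fintype V] [DecidableEq V] in
theorem measurable_hitCount (q : ℝ) (W : Finset ι) (F : ι → Finset V) :
    Measurable (hitCount q W F) :=
  Finset.measurable_sum _ fun w _ =>
    measurable_const.indicator (measurableSet_exists_draw_gt q (F w))

omit [Fintype V] in
theorem dependsOn_hitCount [DecidableEq ι] (q : ℝ) (W : Finset ι) (F : ι → Finset V) :
    DependsOn (hitCount q W F) ((W.biUnion F : Finset V) : Set V) := by
  intro x y hxy
  refine Finset.sum_congr rfl fun w hw => ?_
  have : (∃ v ∈ F w, 1 - q < x v) ↔ ∃ v ∈ F w, 1 - q < y v := by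
    refine exists_congr fun v => and_congr_right fun hv => ?_
    rw [hxy v (Finset.mem_coe.mpr (Finset.mem_biUnion.mpr ⟨w, hw, hv⟩))]
  simp only [Set.indicator_apply, Set.mem_ofPred_eq, this]

/-- Disjoint sets have independent draws, so the transform factorises. With x = q * |F w| ≤ 1/15,
the set is hit with probability at least 1 - exp(-x) ≥ x - x² ≥ 14x/15, and 0.589 is just below
(14/15)(1 - 1/e). -/
theorem mgf_hitCount_le {q : ℝ} (hq0 : 0 ≤ q) (hq1 : q ≤ 1) (W : Finset ι) (F : ι → Finset V)
    (hdisj : (W : Set ι).PairwiseDisjoint F) (hsize : ∀ w ∈ W, q * (F w).card ≤ 1 / 15) :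
    mgf (hitCount q W F) (drawLaw V) (-1) ≤
      Real.exp (-(0.589 * (q * ∑ w ∈ W, ((F w).card : ℝ)))) := by
  classical
  induction W using Finset.induction_on with
  | empty =>
    have : hitCount q (∅ : Finset ι) F = 0 := by ext u; simp [hitCount]
    rw [this]; simp
  | insert w W hw ih =>
    have hsum : hitCount q (insert w W) F = hitCount q {w} F + hitCount q W F := by
      ext u; simp [hitCount, Finset.sum_insert hw]
    have hind : IndepFun (hitCount q {w} F) (hitCount q W F) (drawLaw V) := by
      refine indepFun_of_dependsOn ?_ (measurable_hitCount q _ F) (measurable_hitCount q _ F)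
        (dependsOn_hitCount q _ F) (dependsOn_hitCount q _ F)
      rw [Finset.singleton_biUnion, Finset.disjoint_biUnion_right]
      intro w' hw'
      exact hdisj (by simp) (by simp [hw']) (by rintro rfl; exact hw hw')
    rw [hsum, hind.mgf_add
      ((measurable_hitCount q _ F).const_mul (-1)).exp.aestronglyMeasurable
      ((measurable_hitCount q _ F).const_mul (-1)).exp.aestronglyMeasurable,
      Finset.sum_insert hw, mul_add, mul_add, neg_add, Real.exp_add]
    refine mul_le_mul ?_ (ih (hdisj.subset (by simp)) fun w' hw' => hsize w' (by simp [hw']))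
      mgf_nonneg (Real.exp_nonneg _)
    have e : (fun u => Real.exp (-1 * hitCount q {w} F u)) = fun u =>
        1 - {u : V → ℝ | ∃ v ∈ F w, 1 - q < u v}.indicator (fun _ => 1 - Real.exp (-1)) u := by
      ext u
      by_cases h : u ∈ {u : V → ℝ | ∃ v ∈ F w, 1 - q < u v}
      · simp [hitCount, Set.indicator_of_mem h]
      · simp [hitCount, Set.indicator_of_notMem h]
    rw [mgf, e, integral_sub (integrable_const _)
      ((integrable_const _).indicator (measurableSet_exists_draw_gt q _)),
      integral_indicator_const _ (measurableSet_exists_draw_gt q _),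
      drawLaw_real_exists_gt hq0 hq1]
    simp only [integral_const, probReal_univ, smul_eq_mul, mul_one]
    set x : ℝ := q * (F w).card with hx
    have hx0 : 0 ≤ x := by positivity
    have hx1 : x ≤ 1 / 15 := hsize w (by simp)
    have h1 : (1 - q) ^ (F w).card ≤ 1 - 14 / 15 * x := by
      have h2 : (1 - q) ^ (F w).card ≤ Real.exp (-x) := by
        calc (1 - q) ^ (F w).card ≤ Real.exp (-q) ^ (F w).card :=
              pow_le_pow_left₀ (by linarith) (Real.one_sub_le_exp_neg q) _
          _ = Real.exp (-x) := by rw [← Real.exp_nat_mul, hx]; ring_nf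
      have h3 := (abs_le.mp (Real.abs_exp_sub_one_sub_id_le (x := -x) (by
        rw [abs_neg, abs_of_nonneg hx0]; linarith))).2
      nlinarith
    have h4 := Real.exp_neg_one_lt_d9
    have h5 := Real.one_sub_le_exp_neg (0.589 * x)
    have h6 : 0.589 * x ≤ (1 - (1 - q) ^ (F w).card) * (1 - Real.exp (-1)) := by
      calc 0.589 * x ≤ (14 / 15 * x) * (1 - Real.exp (-1)) := by nlinarith
        _ ≤ _ := mul_le_mul_of_nonneg_right (by linarith) (by linarith)
    linarith

/-- A Chernoff bound for the number of sets of a disjoint family that contain a vertex whose draw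
exceeds `1 - q`. -/
theorem lower_tail {q : ℝ} (hq0 : 0 ≤ q) (hq1 : q ≤ 1) (W : Finset ι) (F : ι → Finset V)
    (hdisj : (W : Set ι).PairwiseDisjoint F) (hsize : ∀ w ∈ W, q * (F w).card ≤ 1 / 15) (t : ℝ) :
    (drawLaw V).real {u | hitCount q W F u ≤ t} ≤
      Real.exp (t - 0.589 * (q * ∑ w ∈ W, ((F w).card : ℝ))) := by
  have hm := measurable_hitCount q W F
  have hnn : ∀ u, 0 ≤ hitCount q W F u := fun u =>
    Finset.sum_nonneg fun w _ => Set.indicator_nonneg (fun _ _ => zero_le_one) _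
  have hint : Integrable (fun u => Real.exp (-1 * hitCount q W F u)) (drawLaw V) := by
    refine Integrable.of_bound (C := 1) (by fun_prop) (Filter.Eventually.of_forall fun u => ?_)
    rw [Real.norm_eq_abs, Real.abs_exp]
    exact Real.exp_le_one_iff.mpr (by linarith [hnn u])
  refine (measure_le_le_exp_mul_mgf (μ := drawLaw V) t (by norm_num : (-1 : ℝ) ≤ 0) hint).trans ?_
  rw [sub_eq_add_neg, Real.exp_add, neg_neg, one_mul]
  exact mul_le_mul_of_nonneg_left (mgf_hitCount_le hq0 hq1 W F hdisj hsize) (Real.exp_nonneg _)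

end Draws

/-! ### Unions of forests: sparsity and large independent sets. -/

section Sparsity

variable {V : Type*} [Fintype V] [DecidableEq V]

-- The forest induced on S extends to a spanning tree of the complete graph on S, which has |S| - 1
-- edges.
open Classical in
omit [Fintype V] [DecidableEq V] in
theorem sum_degree_lt_of_isAcyclic {F : SimpleGraph V} (hF : F.IsAcyclic) {S : Finset V}
    (hS : S.Nonempty) :
    ∑ v ∈ S, ({w ∈ S | F.Adj v w} : Finset V).card < 2 * S.card := by
  have : Nonempty S := hS.to_subtype
  obtain ⟨T, hle, -, hT⟩ := (SimpleGraph.connected_top (V := S)).exists_isTree_le_of_le_of_isAcyclic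
    le_top (hF.induce (S : Set V))
  have h1 := hT.card_edgeFinset
  have h2 := T.sum_degrees_eq_twice_card_edges
  have h3 : ∑ v ∈ S, ({w ∈ S | F.Adj v w} : Finset V).card ≤ ∑ v : S, T.degree v := by
    rw [← Finset.sum_coe_sort]
    refine Finset.sum_le_sum fun v _ => ?_
    rw [← SimpleGraph.card_neighborFinset_eq_degree,
      ← Finset.card_map (Function.Embedding.subtype (· ∈ S))]
    refine Finset.card_le_card fun w hw => ?_
    rw [Finset.mem_filter] at hw
    exact Finset.mem_map.mpr ⟨⟨w, hw.1⟩, by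
      simpa using hle (show (F.induce (S : Set V)).Adj v ⟨w, hw.1⟩ from hw.2), rfl⟩
  rw [Fintype.card_coe] at h1
  omega

variable (G : SimpleGraph V) [DecidableRel G.Adj]

omit [Fintype V] [DecidableEq V] in
theorem mem_activeNbrs {A : Finset V} {v w : V} : w ∈ activeNbrs G A v ↔ w ∈ A ∧ G.Adj v w := by
  simp [activeNbrs]

omit [Fintype V] [DecidableEq V] in
theorem activeNbrs_mono {A A' : Finset V} (h : A ⊆ A') (v : V) :
    activeNbrs G A v ⊆ activeNbrs G A' v :=
  Finset.filter_subset_filter _ h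

omit [Fintype V] [DecidableEq V] in
theorem activeDeg_mono {A A' : Finset V} (h : A ⊆ A') (v : V) :
    activeDeg G A v ≤ activeDeg G A' v :=
  Finset.card_le_card (activeNbrs_mono G h v)

variable {G} {a : ℕ}

omit [Fintype V] in
theorem sum_activeDeg_lt (hG : HasForestPartition G a) (ha : 0 < a) {S : Finset V}
    (hS : S.Nonempty) : ∑ v ∈ S, activeDeg G S v < 2 * a * S.card := by
  classical
  obtain ⟨F, hF, -, rfl⟩ := hG
  have : Nonempty (Fin a) := ⟨⟨0, ha⟩⟩
  calc ∑ v ∈ S, activeDeg (⨆ j, F j) S v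
      ≤ ∑ v ∈ S, ∑ j, ({w ∈ S | (F j).Adj v w} : Finset V).card := by
        refine Finset.sum_le_sum fun v _ => le_trans (Finset.card_le_card ?_) Finset.card_biUnion_le
        intro w hw
        rw [mem_activeNbrs, SimpleGraph.iSup_adj] at hw
        obtain ⟨hw, j, hj⟩ := hw
        simp only [Finset.mem_biUnion, Finset.mem_filter, Finset.mem_univ, true_and]
        exact ⟨j, hw, hj⟩
    _ = ∑ j, ∑ v ∈ S, ({w ∈ S | (F j).Adj v w} : Finset V).card := Finset.sum_comm
    _ < ∑ _j : Fin a, 2 * S.card :=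
        Finset.sum_lt_sum_of_nonempty Finset.univ_nonempty fun j _ =>
          sum_degree_lt_of_isAcyclic (hF j) hS
    _ = 2 * a * S.card := by simp; ring

omit [Fintype V] in
/-- A graph that is a union of `a` forests is `(2a - 1)`-degenerate, so that every set `X` of
vertices contains an independent set of size at least `|X| / (2a)`. -/
theorem exists_independent_subset (hG : HasForestPartition G a) (ha : 0 < a) (X : Finset V) :
    ∃ I ⊆ X, (∀ v ∈ I, ∀ w ∈ I, ¬ G.Adj v w) ∧ X.card ≤ 2 * a * I.card := by
  induction X using Finset.strongInduction with
  | H X ih =>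
    rcases X.eq_empty_or_nonempty with rfl | hX
    · exact ⟨∅, by simp⟩
    have hlt : ∑ v ∈ X, activeDeg G X v < ∑ _v ∈ X, 2 * a := by
      have := sum_activeDeg_lt hG ha hX
      rw [Finset.sum_const, smul_eq_mul]
      linarith
    obtain ⟨v, hv, hdeg⟩ := Finset.exists_lt_of_sum_lt hlt
    -- Taking v into I costs v and its fewer than 2a neighbours, so at most 2a vertices of X.
    obtain ⟨I, hI, hind, hcard⟩ := ih (X \ insert v (activeNbrs G X v))
      (Finset.ssubset_iff_subset_ne.mpr ⟨Finset.sdiff_subset, fun h => by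
        have := h ▸ hv
        simp at this⟩)
    have hvI : v ∉ I := fun h => by simpa using hI h
    have hadj : ∀ w ∈ I, ¬ G.Adj v w := fun w hw h => by
      have := hI hw
      simp [mem_activeNbrs] at this
      exact this.2.2 this.1 h
    refine ⟨insert v I, ?_, ?_, ?_⟩
    · exact Finset.insert_subset hv (hI.trans Finset.sdiff_subset)
    · intro x hx y hy hxy
      rw [Finset.mem_insert] at hx hy
      rcases hx with rfl | hx <;> rcases hy with rfl | hy
      · exact hxy.ne rfl
      · exact hadj y hy hxy
      · exact hadj x hx hxy.symm
      · exact hind x hx y hy hxy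
    · rw [Finset.card_insert_of_notMem hvI]
      have h1 := Finset.le_card_sdiff (insert v (activeNbrs G X v)) X
      have h2 := Finset.card_insert_le v (activeNbrs G X v)
      rw [activeDeg] at hdeg
      rw [mul_add]
      omega

omit [Fintype V] in
/-- If every `w ∈ M` has a set `C w` of `m` neighbours, then there is a large independent set of
vertices `v`, each with a chosen `π v ∈ M` such that `v ∈ C (π v)`. -/
theorem exists_independent_candidates (hG : HasForestPartition G a) (ha : 0 < a) (M : Finset V)
    (C : V → Finset V) (m : ℕ) (hC : ∀ w ∈ M, ∀ v ∈ C w, G.Adj w v)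
    (hm : ∀ w ∈ M, (C w).card = m) :
    ∃ (I : Finset V) (π : V → V), (∀ v ∈ I, ∀ w ∈ I, ¬ G.Adj v w) ∧
      (∀ v ∈ I, π v ∈ M ∧ v ∈ C (π v)) ∧ M.card * m ≤ 2 * a * (M.card + 2 * a * I.card) := by
  classical
  obtain ⟨I, hI, hind, hcard⟩ := exists_independent_subset hG ha (M.biUnion C)
  have hex : ∀ v : V, ∃ w, v ∈ I → w ∈ M ∧ v ∈ C w := by
    intro v
    by_cases hv : v ∈ I
    · obtain ⟨w, hw⟩ := Finset.mem_biUnion.mp (hI hv)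
      exact ⟨w, fun _ => hw⟩
    · exact ⟨v, fun h => absurd h hv⟩
  choose π hπ using hex
  refine ⟨I, π, hind, hπ, ?_⟩
  rcases M.eq_empty_or_nonempty with rfl | hM
  · simp
  -- The degree sum inside S is at least |M| m because of the candidates, but below 2a|S| by
  -- sparsity; so the union of the candidate sets is large.
  set S := M ∪ M.biUnion C
  have h1 : M.card * m ≤ ∑ v ∈ S, activeDeg G S v := by
    calc M.card * m = ∑ w ∈ M, (C w).card := by rw [Finset.sum_congr rfl hm]; simp
      _ ≤ ∑ w ∈ M, activeDeg G S w := by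
        refine Finset.sum_le_sum fun w hw => Finset.card_le_card fun v hv => ?_
        exact (mem_activeNbrs G).mpr ⟨Finset.mem_union_right _ (Finset.mem_biUnion.mpr ⟨w, hw, hv⟩),
          hC w hw v hv⟩
      _ ≤ _ := Finset.sum_le_sum_of_subset Finset.subset_union_left
  have h2 := sum_activeDeg_lt hG ha (S := S) (hM.mono Finset.subset_union_left)
  have h3 : S.card ≤ M.card + 2 * a * I.card :=
    (Finset.card_union_le _ _).trans (by omega)
  exact h1.trans (h2.le.trans (Nat.mul_le_mul_left _ h3))

end Sparsity

/-! ### What the removal of bad nodes guarantees during the next scale. -/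

section Invariant

variable {V : Type*} [Fintype V] [DecidableEq V] (G : SimpleGraph V) [DecidableRel G.Adj]

theorem iterations_active_subset (k : ℕ) (s : State V) (u : ℕ → V → ℝ) (i : ℕ) :
    (iterations G k s u i).active ⊆ s.active := by
  induction i with
  | zero => exact subset_rfl
  | succ i ih => exact Finset.sdiff_subset.trans ih

/-- During scale `k`, every active node has few active neighbours of large active degree. -/
theorem card_high_activeNbrs_le (α : ℕ) (p : ℝ) (u : ℕ → ℕ → V → ℝ) (k i : ℕ) {w : V}
    (hw : w ∈ (stateBefore G α p u (k + 1) i).active) :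
    (({x ∈ activeNbrs G (stateBefore G α p u (k + 1) i).active w |
      (activeDeg G (stateBefore G α p u (k + 1) i).active x : ℝ) >
        (G.maxDegree : ℝ) / 2 ^ k + α} : Finset V).card : ℝ) ≤ (G.maxDegree : ℝ) / 2 ^ (k + 2) := by
  have hsub := iterations_active_subset G (k + 1) (afterScale G α p u k) (u (k + 1)) i
  rw [stateBefore, Nat.add_sub_cancel] at hw ⊢
  cases k with
  | zero =>
    -- In the first scale nothing has been removed, but the threshold is Δ + α, which no degree
    -- exceeds.
    rw [Finset.filter_false_of_mem]
    · simp; positivity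
    · intro x _
      have h1 : activeDeg G (iterations G (0 + 1) (afterScale G α p u 0) (u (0 + 1)) i).active x ≤
          G.maxDegree := by
        refine le_trans (Finset.card_le_card fun y hy => ?_) (G.degree_le_maxDegree x)
        simpa using ((mem_activeNbrs G).mp hy).2
      have h2 : (activeDeg G (iterations G (0 + 1) (afterScale G α p u 0) (u (0 + 1)) i).active x
        : ℝ) ≤ G.maxDegree := by exact_mod_cast h1
      have h3 : (0 : ℝ) ≤ α := Nat.cast_nonneg _
      simp only [pow_zero, div_one, gt_iff_lt, not_lt]
      linarith
  | succ k =>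
    set s := iterations G (k + 1) (afterScale G α p u k) (u (k + 1))
      (numIterations G.maxDegree α p)
    have hs : (afterScale G α p u (k + 1)).active = s.active \ badNodes G α (k + 1) s.active := rfl
    rw [hs] at hsub
    have hw' := Finset.mem_sdiff.mp (hsub hw)
    -- Survival means that w was not bad at the end of the previous scale; active sets only shrink,
    -- so the bound persists.
    have hnot : ¬ _ := fun h => hw'.2 (Finset.mem_filter.mpr ⟨hw'.1, h⟩)
    rw [gt_iff_lt, not_lt] at hnot
    refine le_trans ?_ hnot
    have hsub' := hsub.trans Finset.sdiff_subset
    refine Nat.cast_le.mpr (Finset.card_le_card fun x hx => ?_)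
    rw [Finset.mem_filter] at hx ⊢
    refine ⟨activeNbrs_mono G hsub' w hx.1, lt_of_lt_of_le hx.2 ?_⟩
    exact_mod_cast activeDeg_mono G hsub' x

end Invariant

/-! ### Isolated hits: conditioning on the draws outside the independent set. -/

section Elimination

variable {V : Type*} [Fintype V] [DecidableEq V] (G : SimpleGraph V) [DecidableRel G.Adj]

/-- The nodes of `A` that compete in an iteration of scale `k`. -/
noncomputable def competitors (k : ℕ) (A : Finset V) : Finset V :=
  {v ∈ A | (activeDeg G A v : ℝ) ≤ rho G.maxDegree k}

/-- The draw of `v` exceeds `1 - q`, and no neighbour of `v` in `B` has such a draw. -/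
def IsIsolatedHit (q : ℝ) (B : Finset V) (u : V → ℝ) (v : V) : Prop :=
  1 - q < u v ∧ ∀ x ∈ B, G.Adj v x → u x ≤ 1 - q

/-- A competitor whose draw exceeds `1 - q`, unlike the draws of the competing neighbours, wins
and eliminates its neighbours. -/
theorem notMem_iteration_active {k : ℕ} {s : State V} {u : V → ℝ} {q : ℝ} (hq : q ≤ 1) {v w : V}
    (hv : v ∈ competitors G k s.active) (hit : IsIsolatedHit G q (competitors G k s.active) u v)
    (hw : w ∈ s.active) (hvw : G.Adj v w) : w ∉ (iteration G k s u).active := by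
  rw [competitors, Finset.mem_filter] at hv
  have hwin : v ∈ winners G k s.active u := by
    refine Finset.mem_filter.mpr ⟨hv.1, fun x hx => ?_⟩
    rw [mem_activeNbrs] at hx
    rw [priority, priority, if_neg (not_lt.mpr hv.2)]
    split_ifs with h
    · linarith [hit.1]
    · exact (hit.2 x (Finset.mem_filter.mpr ⟨hx.1, not_lt.mp h⟩) hx.2).trans_lt hit.1
  refine fun h => (Finset.mem_sdiff.mp h).2 (Finset.mem_union_right _ ?_)
  exact Finset.mem_biUnion.mpr
    ⟨v, Finset.mem_union_right _ hwin, (mem_activeNbrs G).mpr ⟨hw, hvw⟩⟩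

open Classical in
/-- Let `I ⊆ B` be an independent set that is partitioned by `π : I → M` into small parts. If the
degrees between `I` and `B` are small, then many parts have an isolated hit. -/
theorem isolatedHits_lower_tail {q : ℝ} (hq0 : 0 ≤ q) (hq1 : q ≤ 1) (B I M : Finset V)
    (π : V → V) (hind : ∀ v ∈ I, ∀ w ∈ I, ¬ G.Adj v w) (hπ : ∀ v ∈ I, π v ∈ M)
    (hfib : ∀ w ∈ M, q * ({v ∈ I | π v = w} : Finset V).card ≤ 1 / 15)
    {b d : ℝ} (hb : 0 < b) (hdegB : ∀ x ∈ B, (({v ∈ I | G.Adj v x} : Finset V).card : ℝ) ≤ b)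
    (hdegI : ∀ v ∈ I, (({x ∈ B | G.Adj v x} : Finset V).card : ℝ) ≤ d) (t : ℝ) :
    (drawLaw V).real {u | (({w ∈ M | ∃ v ∈ I, π v = w ∧ IsIsolatedHit G q B u v} :
        Finset V).card : ℝ) ≤ t} ≤
      Real.exp ((-((I.card : ℝ) / 2) + 3 / 2 * q * (d * I.card)) / (2 * b)) +
        Real.exp (t - 0.589 * (q * ((I.card : ℝ) / 2))) := by
  set n : V → ℝ := fun x => (({v ∈ I | G.Adj v x} : Finset V).card : ℝ) with hn
  set h : V → ℝ := fun x => if x ∈ B \ I then n x else 0 with hh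
  set X : (V → ℝ) → Finset V := fun u => {x ∈ B \ I | 1 - q < u x} with hX
  set F : Finset V → V → Finset V := fun S w => {v ∈ I | π v = w ∧ ∀ x ∈ S, ¬ G.Adj v x} with hF
  set E : Set (V → ℝ) := {u | (I.card : ℝ) / 2 ≤ ∑ v, if 1 - q < u v then h v else 0} with hE
  set 𝒮 : Finset (Finset V) := {S ∈ (B \ I).powerset | ∑ x ∈ S, n x < (I.card : ℝ) / 2} with h𝒮
  have hXsum : ∀ u, (∑ v, if 1 - q < u v then h v else 0) = ∑ x ∈ X u, n x := by
    intro u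
    rw [hX, Finset.sum_filter, ← Finset.sum_filter_add_sum_filter_not Finset.univ (· ∈ B \ I)]
    rw [Finset.sum_eq_zero (s := Finset.univ.filter (· ∉ B \ I)), add_zero,
      Finset.filter_univ_mem]
    · refine Finset.sum_congr rfl fun x hx => ?_
      simp only [hh, if_pos hx]
    · intro x hx
      rw [Finset.mem_filter] at hx
      simp only [hh, if_neg hx.2, ite_self]
  -- Either the hits outside I block too much (event `E`), or their set is some S of total weight
  -- below |I|/2 and few of the fibres left unblocked by S are hit.
  have hcover : {u : V → ℝ | (({w ∈ M | ∃ v ∈ I, π v = w ∧ IsIsolatedHit G q B u v} :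
      Finset V).card : ℝ) ≤ t} ⊆
      E ∪ ⋃ S ∈ 𝒮, ({u | X u = S} ∩ {u | hitCount q M (F S) u ≤ t}) := by
    intro u hu
    by_cases hEu : u ∈ E
    · exact Or.inl hEu
    right
    rw [hE, Set.mem_ofPred_eq, not_le, hXsum] at hEu
    simp only [Set.mem_iUnion]
    refine ⟨X u, Finset.mem_filter.mpr
      ⟨Finset.mem_powerset.mpr (Finset.filter_subset _ _), hEu⟩, rfl, ?_⟩
    refine le_trans ?_ (show _ ≤ t from hu)
    have : hitCount q M (F (X u)) u =
        (({w ∈ M | ∃ v ∈ F (X u) w, 1 - q < u v} : Finset V).card : ℝ) := by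
      simp [hitCount, Set.indicator_apply, Finset.sum_boole]
    rw [this]
    refine Nat.cast_le.mpr (Finset.card_le_card fun w hw => ?_)
    rw [Finset.mem_filter] at hw ⊢
    obtain ⟨hw, v, hv, huv⟩ := hw
    rw [hF, Finset.mem_filter] at hv
    refine ⟨hw, v, hv.1, hv.2.1, huv, fun x hx hvx => not_lt.mp fun hux => ?_⟩
    exact hv.2.2 x (Finset.mem_filter.mpr
      ⟨Finset.mem_sdiff.mpr ⟨hx, fun hxI => hind v hv.1 x hxI hvx⟩, hux⟩) hvx
  have hE_le : (drawLaw V).real E ≤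
      Real.exp ((-((I.card : ℝ) / 2) + 3 / 2 * q * (d * I.card)) / (2 * b)) := by
    refine (upper_tail hq0 hq1 h hb (fun v => ?_) (fun v => ?_) _).trans ?_
    · simp only [hh]; split_ifs <;> positivity
    · simp only [hh]; split_ifs with hv
      · exact hdegB v (Finset.mem_sdiff.mp hv).1
      · exact hb.le
    · have : ∑ v, h v ≤ d * I.card := by
        calc ∑ v, h v = ∑ x ∈ B \ I, n x := by
              simp only [hh, Finset.sum_ite_mem, Finset.univ_inter]
          _ ≤ ∑ x ∈ B, n x := Finset.sum_le_sum_of_subset_of_nonneg Finset.sdiff_subset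
              fun _ _ _ => Nat.cast_nonneg _
          _ = ∑ v ∈ I, (({x ∈ B | G.Adj v x} : Finset V).card : ℝ) := by
              simp only [hn, ← Finset.sum_boole]
              exact Finset.sum_comm
          _ ≤ ∑ _v ∈ I, d := Finset.sum_le_sum hdegI
          _ = d * I.card := by simp [mul_comm]
      gcongr
  have hXmeas : ∀ S, MeasurableSet {u : V → ℝ | X u = S} := by
    intro S
    have : {u : V → ℝ | X u = S} = ⋂ x, {u : V → ℝ | (x ∈ B \ I ∧ 1 - q < u x) ↔ x ∈ S} := by
      ext u
      simp only [hX, Finset.ext_iff, Finset.mem_filter, Set.mem_ofPred_eq, Set.mem_iInter]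
    rw [this]
    refine MeasurableSet.iInter fun x => ?_
    by_cases hx : x ∈ B \ I <;> by_cases hxS : x ∈ S <;> simp only [hx, hxS, true_and, false_and,
      iff_true, iff_false, MeasurableSet.const]
    · exact measurableSet_draw_gt q x
    · exact (measurableSet_draw_gt q x).compl
  have hS_le : ∀ S ∈ 𝒮, (drawLaw V).real ({u | X u = S} ∩ {u | hitCount q M (F S) u ≤ t}) ≤
      (drawLaw V).real {u | X u = S} * Real.exp (t - 0.589 * (q * ((I.card : ℝ) / 2))) := by
    intro S hS
    rw [h𝒮, Finset.mem_filter] at hS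
    have hFI : M.biUnion (F S) ⊆ I := Finset.biUnion_subset.mpr fun w _ => Finset.filter_subset _ _
    -- For fixed S the first event reads only draws in B \ I and the count reads only draws in I.
    have hindep : IndepFun (fun u => X u = S) (hitCount q M (F S)) (drawLaw V) := by
      refine indepFun_of_dependsOn (S := B \ I) (T := I) Finset.sdiff_disjoint
        (measurableSet_setOfPred.mp (hXmeas S)) (measurable_hitCount q M _) ?_
        ((dependsOn_hitCount q M (F S)).mono (Finset.coe_subset.mpr hFI))
      intro x y hxy
      have : X x = X y := Finset.filter_congr fun v hv => by rw [hxy v hv]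
      simp only [this]
    have hmul := hindep.measure_inter_preimage_eq_mul {True} (Set.Iic t)
      (measurableSet_singleton _) measurableSet_Iic
    have e1 : (fun u => X u = S) ⁻¹' {True} = {u | X u = S} := by ext u; simp
    have e2 : hitCount q M (F S) ⁻¹' Set.Iic t = {u | hitCount q M (F S) u ≤ t} := rfl
    rw [e1, e2] at hmul
    rw [measureReal_def, hmul, ENNReal.toReal_mul]
    refine mul_le_mul_of_nonneg_left ?_ ENNReal.toReal_nonneg
    refine (lower_tail hq0 hq1 M (F S) ?_ (fun w hw => ?_) t).trans ?_
    · intro w _ w' _ hne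
      refine Finset.disjoint_left.mpr fun v hv hv' => hne ?_
      rw [hF, Finset.mem_filter] at hv hv'
      exact hv.2.1.symm.trans hv'.2.1
    · refine le_trans ?_ (hfib w hw)
      refine mul_le_mul_of_nonneg_left (Nat.cast_le.mpr (Finset.card_le_card fun v hv => ?_)) hq0
      rw [hF, Finset.mem_filter] at hv
      exact Finset.mem_filter.mpr ⟨hv.1, hv.2.1⟩
    · have h1 : ∑ w ∈ M, (F S w).card = ({v ∈ I | ∀ x ∈ S, ¬ G.Adj v x} : Finset V).card := by
        rw [Finset.card_eq_sum_card_fiberwise (f := π) (t := M)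
          fun v hv => hπ v (Finset.mem_filter.mp hv).1]
        refine Finset.sum_congr rfl fun w _ => ?_
        rw [Finset.filter_filter, hF]
        simp only [and_comm]
      have h2 : (I.card : ℝ) ≤ ({v ∈ I | ∀ x ∈ S, ¬ G.Adj v x} : Finset V).card +
          ∑ x ∈ S, n x := by
        rw [← Finset.card_filter_add_card_filter_not (s := I) (fun v => ∀ x ∈ S, ¬ G.Adj v x)]
        push_cast
        gcongr
        rw [hn, ← Nat.cast_sum]
        refine Nat.cast_le.mpr (le_trans (Finset.card_le_card ?_) Finset.card_biUnion_le)
        intro v hv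
        simp only [Finset.mem_filter, not_forall, not_not, Finset.mem_biUnion] at hv ⊢
        obtain ⟨hv, x, hx, hvx⟩ := hv
        exact ⟨x, hx, hv, hvx⟩
      have h3 : (I.card : ℝ) / 2 ≤ ∑ w ∈ M, ((F S w).card : ℝ) := by
        rw [← Nat.cast_sum, h1]
        linarith [hS.2]
      gcongr
  -- The events X u = S are disjoint, so summing over exponentially many S costs nothing.
  have hsum : ∑ S ∈ 𝒮, (drawLaw V).real {u | X u = S} ≤ 1 := by
    rw [← measureReal_biUnion_finset (fun S _ S' _ hne => ?_) fun S _ => hXmeas S]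
    · exact measureReal_le_one
    · exact Set.disjoint_left.mpr fun u hu hu' => hne (Eq.trans (Eq.symm hu) hu')
  calc _ ≤ (drawLaw V).real (E ∪ ⋃ S ∈ 𝒮, ({u | X u = S} ∩ {u | hitCount q M (F S) u ≤ t})) :=
        measureReal_mono hcover
    _ ≤ (drawLaw V).real E +
        ∑ S ∈ 𝒮, (drawLaw V).real ({u | X u = S} ∩ {u | hitCount q M (F S) u ≤ t}) :=
        (measureReal_union_le _ _).trans (by gcongr; exact measureReal_biUnion_finset_le _ _)
    _ ≤ _ := by
        gcongr
        refine (Finset.sum_le_sum hS_le).trans ?_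
        rw [← Finset.sum_mul]
        exact mul_le_of_le_one_left (Real.exp_nonneg _) hsum

end Elimination

/-! ### Numerical estimates. -/

section Parameters

/-- If there is a scale `k`, then `Δ / 2^k` is large. -/
theorem parameters_of_le_numScales {Δ α k : ℕ} (hk : 1 ≤ k) (hkΘ : k ≤ numScales Δ α) :
    0 < α ∧ 1 < Δ ∧ 18816 * (α : ℝ) ^ 10 * Real.log Δ ^ 2 ≤ (Δ : ℝ) / 2 ^ k := by
  set y : ℝ := 1176 * 16 * (α : ℝ) ^ 10 * Real.log Δ ^ 2 with hy
  have hlog : (k : ℝ) ≤ Real.logb 2 ((Δ : ℝ) / y) :=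
    (Nat.le_floor_iff' (by omega)).mp hkΘ
  have hx0 : 0 ≤ (Δ : ℝ) / y := by positivity
  have hx : (Δ : ℝ) / y ≠ 0 := by
    intro h
    rw [h, Real.logb_zero] at hlog
    have : (1 : ℝ) ≤ k := by exact_mod_cast hk
    linarith
  have hxpos := lt_of_le_of_ne hx0 hx.symm
  rw [Real.le_logb_iff_rpow_le (by norm_num) hxpos, Real.rpow_natCast] at hlog
  obtain ⟨hΔ, hy0⟩ := div_ne_zero_iff.mp hx
  have hypos : 0 < y := lt_of_le_of_ne (by positivity) hy0.symm
  refine ⟨?_, ?_, ?_⟩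
  · rcases Nat.eq_zero_or_pos α with rfl | h
    · simp [hy] at hy0
    · exact h
  · by_contra h
    interval_cases Δ <;> simp [hy] at hy0
  · rw [le_div_iff₀ hypos] at hlog
    rw [le_div_iff₀ (by positivity)]
    linarith

/-- A bootstrap: ln Δ ≥ ln 2 already forces Δ ≥ 8000 through the hypothesis, and 8000 exceeds e^6.
-/
theorem six_le_log {Δ : ℕ} (hΔ : 1 < Δ) (h : 18816 * Real.log Δ ^ 2 ≤ Δ) :
    6 ≤ Real.log Δ := by
  have h2 : (2 : ℝ) ≤ Δ := by exact_mod_cast hΔ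
  have h3 : 0.69 ≤ Real.log Δ :=
    (by linarith [Real.log_two_gt_d9] : (0.69 : ℝ) ≤ Real.log 2).trans
      (Real.log_le_log (by norm_num) h2)
  rw [Real.le_log_iff_exp_le (by linarith)]
  calc Real.exp 6 = Real.exp 1 ^ 6 := by rw [← Real.exp_nat_mul]; norm_num
    _ ≤ 2.7182818286 ^ 6 := pow_le_pow_left₀ (Real.exp_nonneg _) Real.exp_one_lt_d9.le _
    _ ≤ 8000 := by norm_num
    _ ≤ Δ := by nlinarith

/-- Since 2aN ≤ ND/18, the hypotheses leave (1/2 - 1/18)ND = 4ND/9 ≤ 4a²I. -/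
theorem independent_card_ge {a D N m I : ℝ} (ha : 1 ≤ a) (hD : 36 * a ≤ D) (hN : 0 ≤ N)
    (hm : D / 2 ≤ m) (h : N * m ≤ 2 * a * (N + 2 * a * I)) : N * D / (9 * a ^ 2) ≤ I := by
  rw [div_le_iff₀ (by positivity)]
  nlinarith [mul_le_mul_of_nonneg_left hm hN, mul_le_mul_of_nonneg_left hD hN]

/-- The mean term is about 3I/8, so a margin of nearly I/8 below I/2 remains; divided by 8LD, with I
≥ 522 L²D, it gives about 8L. -/
theorem upper_exponent_le {a L D N I : ℝ} (ha : 1 ≤ a) (hL : 6 ≤ L)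
    (hD : 18816 * a ^ 2 * L ^ 2 ≤ D) (hDa : 1000 * a ≤ D) (hN : D / 4 ≤ N)
    (hI : N * D / (9 * a ^ 2) ≤ I) :
    (-(I / 2) + 3 / 2 * (1 / (8 * D)) * ((2 * D + a) * I)) / (2 * (4 * L * D)) ≤ -6 * L := by
  have hD0 : 0 < D := by linarith
  have hI1 : 522 * L ^ 2 * D ≤ I := by
    refine le_trans ?_ hI
    rw [le_div_iff₀ (by positivity)]
    nlinarith [mul_le_mul_of_nonneg_right hD hD0.le, mul_le_mul_of_nonneg_right hN hD0.le]
  have hI0 : 0 ≤ I := le_trans (by positivity) hI1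
  have h1 : 1 / (8 * D) * (2 * D + a) ≤ 0.2502 := by
    rw [one_div_mul_eq_div, div_le_iff₀ (by positivity)]
    linarith
  rw [div_le_iff₀ (by positivity)]
  have h2 : 3 / 2 * (1 / (8 * D)) * ((2 * D + a) * I) ≤ 3 / 2 * (0.2502 * I) := by
    calc _ = 3 / 2 * ((1 / (8 * D) * (2 * D + a)) * I) := by ring
      _ ≤ _ := by gcongr
  have h3 : 0 ≤ L ^ 2 * D := by positivity
  nlinarith

/-- The mean is at least N/(144a²), and 0.589/144 exceeds 1/264; the small gap times N/a² ≥ 4704 L²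
still beats 6L. -/
theorem lower_exponent_le {a L D N I : ℝ} (ha : 1 ≤ a) (hL : 6 ≤ L) (hD0 : 0 < D)
    (hN : 4704 * a ^ 2 * L ^ 2 ≤ N) (hI : N * D / (9 * a ^ 2) ≤ I) :
    N / (264 * a ^ 2) - 0.589 * (1 / (8 * D) * (I / 2)) ≤ -6 * L := by
  have h1 : N / (144 * a ^ 2) ≤ 1 / (8 * D) * (I / 2) := by
    calc N / (144 * a ^ 2) = 1 / (8 * D) * (N * D / (9 * a ^ 2) / 2) := by
          field_simp; ring
      _ ≤ _ := by gcongr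
  have h2 : N / (264 * a ^ 2) = (N / a ^ 2) / 264 := by field_simp
  have h3 : N / (144 * a ^ 2) = (N / a ^ 2) / 144 := by field_simp
  have h4 : 4704 * L ^ 2 ≤ N / a ^ 2 := by
    rw [le_div_iff₀ (by positivity)]; linarith
  rw [h3] at h1
  rw [h2]
  nlinarith

theorem two_mul_exp_le {L : ℝ} (hL : 6 ≤ L) :
    Real.exp (-6 * L) + Real.exp (-6 * L) ≤ Real.exp (-3 * L) := by
  have h1 : Real.exp (-6 * L) = Real.exp (-3 * L) * Real.exp (-3 * L) := by
    rw [← Real.exp_add]; ring_nf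
  have h2 : Real.exp (-3 * L) ≤ 1 / 2 :=
    (Real.exp_le_exp.mpr (by linarith)).trans Real.exp_neg_one_lt_half.le
  nlinarith [Real.exp_pos (-3 * L)]

end Parameters

/-! ### One iteration, and the theorem. -/

/-- In one iteration from a state in which every node of `M` has large active degree but few active
neighbours of much larger active degree, a constant fraction of `M` is eliminated with high
probability. -/
theorem eliminated_lower_tail {V : Type*} [Fintype V] [DecidableEq V] (G : SimpleGraph V)
    [DecidableRel G.Adj] {a : ℕ} (hG : HasForestPartition G a) (ha : 0 < a) (k : ℕ) (s : State V)
    {D L : ℝ} (hDdef : D = (G.maxDegree : ℝ) / 2 ^ k) (hLdef : L = Real.log G.maxDegree)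
    (hL : 6 ≤ L) (hD : 18816 * (a : ℝ) ^ 10 * L ^ 2 ≤ D)
    (M : Finset V) (hM : M ⊆ s.active) (hMcard : D / 4 ≤ M.card)
    (hMdeg : ∀ w ∈ M, D + a < activeDeg G s.active w)
    (hhigh : ∀ w ∈ M, (({x ∈ activeNbrs G s.active w |
      2 * D + a < (activeDeg G s.active x : ℝ)} : Finset V).card : ℝ) ≤ D / 2) :
    (drawLaw V).real {u | ((M \ (iteration G k s u).active).card : ℝ) ≤
      (M.card : ℝ) / (264 * (a : ℝ) ^ 2)} ≤ Real.exp (-3 * L) := by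
  classical
  have ha1 : (1 : ℝ) ≤ a := by exact_mod_cast ha
  have hD2 : 18816 * (a : ℝ) ^ 2 * L ^ 2 ≤ D := by
    refine le_trans ?_ hD
    have : (a : ℝ) ^ 2 ≤ (a : ℝ) ^ 10 := pow_le_pow_right₀ ha1 (by norm_num)
    gcongr
  have hDa : 1000 * (a : ℝ) ≤ D := by
    refine le_trans ?_ hD2
    nlinarith [mul_le_mul hL hL (by norm_num) (by linarith), sq_nonneg (a : ℝ)]
  have hD0 : 0 < D := by linarith
  set A := s.active
  set low : V → Finset V := fun w =>
    {x ∈ activeNbrs G A w | (activeDeg G A x : ℝ) ≤ 2 * D + a} with hlow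
  set m : ℕ := ⌊D / 2⌋₊ + 1 with hm
  have hm_ge : D / 2 ≤ m := by rw [hm]; push_cast; exact (Nat.lt_floor_add_one _).le
  have hm_le : (m : ℝ) ≤ D / 2 + 1 := by
    rw [hm]; push_cast
    linarith [Nat.floor_le (by positivity : 0 ≤ D / 2)]
  have hlow_card : ∀ w ∈ M, m ≤ (low w).card := by
    intro w hw
    have h1 := Finset.card_filter_add_card_filter_not (s := activeNbrs G A w)
      (fun x => (activeDeg G A x : ℝ) ≤ 2 * D + a)
    simp only [not_le] at h1
    have h2 : ((low w).card : ℝ) + (({x ∈ activeNbrs G A w |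
        2 * D + a < (activeDeg G A x : ℝ)} : Finset V).card : ℝ) = activeDeg G A w := by
      exact_mod_cast h1
    have h3 := hhigh w hw
    have h4 := hMdeg w hw
    rw [hm]
    exact Nat.succ_le_of_lt ((Nat.floor_lt (by positivity)).mpr (by linarith))
  have hex : ∀ w, ∃ C : Finset V, w ∈ M → C ⊆ low w ∧ C.card = m := by
    intro w
    by_cases hw : w ∈ M
    · obtain ⟨C, hC⟩ := Finset.exists_subset_card_eq (hlow_card w hw)
      exact ⟨C, fun _ => hC⟩
    · exact ⟨∅, fun h => absurd h hw⟩
  choose C hC using hex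
  have hCadj : ∀ w ∈ M, ∀ v ∈ C w, G.Adj w v := fun w hw v hv =>
    ((mem_activeNbrs G).mp (Finset.mem_filter.mp ((hC w hw).1 hv)).1).2
  obtain ⟨I, π, hind, hπ, hcard⟩ := exists_independent_candidates hG ha M C m hCadj
    fun w hw => (hC w hw).2
  have hIlow : ∀ v ∈ I, v ∈ A ∧ (activeDeg G A v : ℝ) ≤ 2 * D + a := by
    intro v hv
    have h := Finset.mem_filter.mp ((hC (π v) (hπ v hv).1).1 (hπ v hv).2)
    exact ⟨((mem_activeNbrs G).mp h.1).1, h.2⟩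
  have hrho : rho G.maxDegree k = 4 * L * D := by
    rw [rho, hDdef, hLdef, pow_succ]; field_simp; ring
  have hIcomp : ∀ v ∈ I, v ∈ competitors G k A := by
    intro v hv
    refine Finset.mem_filter.mpr ⟨(hIlow v hv).1, (hIlow v hv).2.trans ?_⟩
    rw [hrho]
    nlinarith
  -- Small enough that a candidate, of active degree at most 2D + a, expects only about 1/4
  -- competing neighbours with a hit; large enough that a fibre of size about D/2 is hit with
  -- constant probability.
  set q : ℝ := 1 / (8 * D) with hq
  have hq0 : 0 ≤ q := by positivity
  have hq1 : q ≤ 1 := by rw [hq, div_le_one (by positivity)]; linarith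
  have hI : (M.card : ℝ) * D / (9 * (a : ℝ) ^ 2) ≤ I.card :=
    independent_card_ge ha1 (by linarith) (Nat.cast_nonneg _) hm_ge (by exact_mod_cast hcard)
  have hfib : ∀ w ∈ M, q * ({v ∈ I | π v = w} : Finset V).card ≤ 1 / 15 := by
    intro w hw
    have h1 : ({v ∈ I | π v = w} : Finset V).card ≤ m := by
      rw [← (hC w hw).2]
      refine Finset.card_le_card fun v hv => ?_
      rw [Finset.mem_filter] at hv
      exact hv.2 ▸ (hπ v hv.1).2
    have h2 : (({v ∈ I | π v = w} : Finset V).card : ℝ) ≤ D / 2 + 1 :=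
      (Nat.cast_le.mpr h1).trans hm_le
    rw [hq, one_div_mul_eq_div, div_le_iff₀ (by positivity)]
    linarith
  have hdegB : ∀ x ∈ competitors G k A,
      (({v ∈ I | G.Adj v x} : Finset V).card : ℝ) ≤ 4 * L * D := by
    intro x hx
    refine le_trans (Nat.cast_le.mpr (Finset.card_le_card fun v hv => ?_))
      ((Finset.mem_filter.mp hx).2.trans_eq hrho)
    rw [Finset.mem_filter] at hv
    exact (mem_activeNbrs G).mpr ⟨(hIlow v hv.1).1, hv.2.symm⟩
  have hdegI : ∀ v ∈ I,
      (({x ∈ competitors G k A | G.Adj v x} : Finset V).card : ℝ) ≤ 2 * D + a := by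
    intro v hv
    refine le_trans (Nat.cast_le.mpr (Finset.card_le_card fun x hx => ?_)) (hIlow v hv).2
    rw [Finset.mem_filter] at hx
    exact (mem_activeNbrs G).mpr ⟨(Finset.mem_filter.mp hx.1).1, hx.2⟩
  have htail := isolatedHits_lower_tail G hq0 hq1 (competitors G k A) I M π hind
    (fun v hv => (hπ v hv).1) hfib (b := 4 * L * D) (by positivity) hdegB hdegI
    ((M.card : ℝ) / (264 * (a : ℝ) ^ 2))
  have hN : 4704 * (a : ℝ) ^ 2 * L ^ 2 ≤ M.card := by linarith
  calc _ ≤ (drawLaw V).real {u | (({w ∈ M | ∃ v ∈ I, π v = w ∧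
          IsIsolatedHit G q (competitors G k A) u v} : Finset V).card : ℝ) ≤
            (M.card : ℝ) / (264 * (a : ℝ) ^ 2)} := by
        refine measureReal_mono fun u hu => ?_
        refine le_trans (Nat.cast_le.mpr (Finset.card_le_card ?_)) (Set.mem_ofPred_eq ▸ hu)
        intro w hw
        obtain ⟨hw, v, hv, hvw, hit⟩ := Finset.mem_filter.mp hw
        refine Finset.mem_sdiff.mpr ⟨hw, notMem_iteration_active G hq1 (hIcomp v hv) hit (hM hw) ?_⟩
        exact (hCadj w hw v (hvw ▸ (hπ v hv).2)).symm
    _ ≤ _ := htail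
    _ ≤ Real.exp (-6 * L) + Real.exp (-6 * L) := by
        gcongr
        · exact upper_exponent_le ha1 hL hD2 hDa hMcard hI
        · exact lower_exponent_le ha1 hL hD0 hN hI
    _ ≤ _ := two_mul_exp_le hL

end BoundedArb

theorem mainTheorem4 {V : Type*} [Fintype V] [DecidableEq V]
    (G : SimpleGraph V) [DecidableRel G.Adj]
    (α : ℕ) (hα : BoundedArb.arboricity G = α)
    (p : ℝ) (hp : 0 < p)
    -- the scale and the iteration
    (k i : ℕ) (hk : 1 ≤ k) (hkΘ : k ≤ BoundedArb.numScales G.maxDegree α)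
    (hi : i < BoundedArb.numIterations G.maxDegree α p)
    -- an arbitrary outcome of the draws of the earlier iterations, and the state it leads to
    (past : ℕ → ℕ → V → ℝ) (hpast : ∀ j l v, past j l v ∈ Set.Ioo (0 : ℝ) 1)
    (s : BoundedArb.State V) (hs : s = BoundedArb.stateBefore G α p past k i)
    (M : Finset V) (hM : M ⊆ s.active)
    (hMcard : (M.card : ℝ) > (G.maxDegree : ℝ) / 2 ^ (k + 2))
    (hMdeg : ∀ w ∈ M,
      (BoundedArb.activeDeg G s.active w : ℝ) > (G.maxDegree : ℝ) / 2 ^ k + α) :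
    (BoundedArb.drawLaw V).real
        {u | ((M \ (BoundedArb.iteration G k s u).active).card : ℝ) ≥
          (M.card : ℝ) / (8 * (α : ℝ) ^ 2 * (32 * (α : ℝ) ^ 6 + 1))}
      ≥ 1 - 1 / (G.maxDegree : ℝ) ^ 3 := by
  obtain ⟨hα0, hΔ, hD⟩ := BoundedArb.parameters_of_le_numScales hk hkΘ
  have hG : BoundedArb.HasForestPartition G α := by
    -- As `sInf ∅ = 0`, positivity of α shows that the infimum is attained.
    have := Nat.sInf_mem (Nat.nonempty_of_pos_sInf (s := {a | BoundedArb.HasForestPartition G a})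
      (hα.symm ▸ hα0 : 0 < BoundedArb.arboricity G))
    rw [← hα]
    exact this
  have hα1 : (1 : ℝ) ≤ α := by exact_mod_cast hα0
  have hL : 6 ≤ Real.log G.maxDegree := by
    refine BoundedArb.six_le_log hΔ (le_trans ?_ (hD.trans
      (div_le_self (Nat.cast_nonneg _) (one_le_pow₀ (by norm_num)))))
    exact mul_le_mul_of_nonneg_right (by linarith [one_le_pow₀ hα1 (n := 10)]) (sq_nonneg _)
  have htail := BoundedArb.eliminated_lower_tail G hG hα0 k s rfl rfl hL hD M hM
    (by rw [div_div, show (2 : ℝ) ^ k * 4 = 2 ^ (k + 2) by ring]; exact hMcard.le) hMdeg (by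
      obtain ⟨k, rfl⟩ := Nat.exists_eq_add_of_le' hk
      intro w hw
      subst hs
      have e1 : 2 * ((G.maxDegree : ℝ) / 2 ^ (k + 1)) = (G.maxDegree : ℝ) / 2 ^ k := by
        rw [pow_succ]; field_simp
      have e2 : (G.maxDegree : ℝ) / 2 ^ (k + 1) / 2 = (G.maxDegree : ℝ) / 2 ^ (k + 2) := by
        rw [div_div, ← pow_succ]
      rw [e1, e2]
      exact BoundedArb.card_high_activeNbrs_le G α p past k i (hM hw))
  have hexp : Real.exp (-3 * Real.log G.maxDegree) = 1 / (G.maxDegree : ℝ) ^ 3 := by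
    have hpos : (0 : ℝ) < G.maxDegree := by exact_mod_cast (zero_lt_one.trans hΔ)
    rw [neg_mul, Real.exp_neg, one_div, show (3 : ℝ) = (3 : ℕ) by norm_num, Real.exp_nat_mul,
      Real.exp_log hpos]
  rw [hexp] at htail
  have hfrac : (M.card : ℝ) / (8 * (α : ℝ) ^ 2 * (32 * (α : ℝ) ^ 6 + 1)) ≤
      (M.card : ℝ) / (264 * (α : ℝ) ^ 2) := by
    refine div_le_div_of_nonneg_left (Nat.cast_nonneg _) (by positivity) ?_
    nlinarith [one_le_pow₀ hα1 (n := 6), sq_nonneg (α : ℝ)]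
  -- Covering the whole space and using subadditivity avoids proving the event measurable, as
  -- passing to a complement would require.
  have hcover : Set.univ ⊆
      {u | ((M \ (BoundedArb.iteration G k s u).active).card : ℝ) ≥
        (M.card : ℝ) / (8 * (α : ℝ) ^ 2 * (32 * (α : ℝ) ^ 6 + 1))} ∪
      {u | ((M \ (BoundedArb.iteration G k s u).active).card : ℝ) ≤
        (M.card : ℝ) / (264 * (α : ℝ) ^ 2)} := fun u _ =>
    (le_total ((M.card : ℝ) / (264 * (α : ℝ) ^ 2))
      ((M \ (BoundedArb.iteration G k s u).active).card : ℝ)).imp hfrac.trans id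
  have hunion := (measureReal_mono (μ := BoundedArb.drawLaw V) hcover).trans
    (measureReal_union_le _ _)
  rw [probReal_univ] at hunion
  linarith
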